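/- Let $(X,\mathrm{dist})$ be a locally compact separable metric space with a Radon measure $\mu$, write $|B|=\mu(B)$, and suppose that for some $D>0$ the doubling condition $0<|B(x,2r)|\le 2^{D}|B(x,r)|$ holds for all open balls. Let $\mathcal L$ be a non-negative self-adjoint operator in the real space $L_2(X,\mu)$ with non-negative square root $\mathcal L^{1/2}$, such that the form $\mathcal E(f,g)=\langle \mathcal L^{1/2}f,\mathcal L^{1/2}g\rangle$ with domain $\mathcal D(\mathcal E)=\mathcal D(\mathcal L^{1/2})$ is a strongly local regular Dirichlet form. For $f\in\mathcal D(\mathcal E)$ let $d\Gamma(f,f)$ be its energy measure: for bounded $f$ it is the finite Borel measure with $\int\varphi\,d\Gamma(f,f)=\mathcal E(f,f\varphi)-\tfrac12\mathcal E(f^2,\varphi)$ for all $\varphi\in\mathcal D(\mathcal E)\cap C_c(X)$, and in general it is the setwise limit of the energy measures of the truncations $\max(-n,\min(f,n))$, $n\to\infty$. Suppose that there are constants $C>0$ and $r_0>0$ such that the local Poincaré inequality $$\int_{B(x,r)}|f-f_{B}|^2\,d\mu\le C r^2\int_{B(x,r)}d\Gamma(f,f),\qquad f_B=\frac1{|B(x,r)|}\int_{B(x,r)}f\,d\mu,$$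 holds for all $f\in\mathcal D(\mathcal L)$, $x\in X$ and $0<r<r_0$. For $\rho>0$ and $N\in\mathbb N$ call a set $\{x_j\}\subset X$ a $\rho$-lattice of multiplicity at most $N$ if the balls $B(x_j,\rho/2)$ are pairwise disjoint, the balls $B(x_j,\rho)$ cover $X$, and no point of $X$ lies in more than $N$ of the balls $B(x_j,\rho)$. Put $\xi_j=|B(x_j,\rho)|^{-1/2}\chi_{B(x_j,\rho)}$. Then there is a natural number $N\le 80^{D}$ such that for every $\rho>0$ there exists a $\rho$-lattice of multiplicity at most $N$. Moreover, for every $N\in\mathbb N$, every $0<\rho<r_0$, every $\rho$-lattice $\{x_j\}$ of multiplicity at most $N$, every $f\in\mathcal D(\mathcal L^{1/2})$ and every $\alpha>0$, the series $\sum_j|\langle f,\xi_j\rangle|^2$ converges and $$\|f\|^2\le(1+\alpha)\,C\,N\,\rho^2\,\|\mathcal L^{1/2}f\|^2+\frac{1+\alpha}{\alpha}\sum_j|\langle f,\xi_j\rangle|^2 .$$ -/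

import Mathlib

open MeasureTheory Metric Filter Topology
open scoped ENNReal

noncomputable section

namespace GlobalPoincare

section SquareRoot

variable {H : Type*} [NormedAddCommGroup H] [InnerProductSpace ℝ H] [CompleteSpace H]

/-- A partially defined operator is non-negative if `⟨A f, f⟩ ≥ 0` on its domain. -/
def IsNonneg (A : H →ₗ.[ℝ] H) : Prop :=
  ∀ f : A.domain, 0 ≤ inner ℝ (A f) (f : H)

/-- `S` is a non-negative self-adjoint operator with `S ∘ S = A`, where the composition has
its natural domain `{f ∈ D(S) | S f ∈ D(S)}`. -/
structure IsNonnegSqrt (A S : H →ₗ.[ℝ] H) : Prop where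
  selfAdjoint : IsSelfAdjoint S
  nonneg : IsNonneg S
  square : ∀ f h : H, (f, h) ∈ A.graph ↔ ∃ g : H, (f, g) ∈ S.graph ∧ (g, h) ∈ S.graph

open scoped Classical in
/-- The non-negative square root `A^{1/2}` of a non-negative self-adjoint operator `A`
(which exists and is unique for such `A`; a default value otherwise). -/
def sqrtOp (A : H →ₗ.[ℝ] H) : H →ₗ.[ℝ] H :=
  if h : ∃ S : H →ₗ.[ℝ] H, IsNonnegSqrt A S then h.choose else 0

end SquareRoot

section Spaces

variable {X : Type*} [MetricSpace X] [MeasurableSpace X]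

/-- The doubling condition `0 < |B(x, 2r)| ≤ 2^D |B(x, r)|`. -/
def IsDoubling (μ : Measure X) (D : ℝ) : Prop :=
  ∀ (x : X) (r : ℝ), 0 < r →
    0 < μ (ball x (2 * r)) ∧ μ (ball x (2 * r)) ≤ (2 : ℝ≥0∞) ^ D * μ (ball x r)

/-- A metric `ρ`-lattice with multiplicity constant `N`: the balls of radius `ρ / 2` are disjoint,
the balls of radius `ρ` cover `X`, and no point lies in more than `N` of the latter. -/
structure IsLattice (N : ℕ) (ρ : ℝ) (Λ : Set X) : Prop where
  disjoint : Λ.PairwiseDisjoint fun p => ball p (ρ / 2)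
  cover : ⋃ p ∈ Λ, ball p ρ = Set.univ
  multiplicity : ∀ x : X, {p ∈ Λ | x ∈ ball p ρ}.encard ≤ N

/-- The function `ξ = |B(p, ρ)|^{-1/2} χ_{B(p, ρ)}`. -/
def xi (μ : Measure X) (ρ : ℝ) (p : X) : X → ℝ :=
  (ball p ρ).indicator fun _ => (μ.real (ball p ρ)) ^ (-(1 / 2) : ℝ)

variable {μ : Measure X}

/-- The bilinear form `E(f, g) = ⟨L^{1/2} f, L^{1/2} g⟩` associated with `L`,
with domain `D(E) = D(L^{1/2})`. -/
def form (L : Lp ℝ 2 μ →ₗ.[ℝ] Lp ℝ 2 μ) (f g : (sqrtOp L).domain) : ℝ :=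
  inner ℝ (sqrtOp L f) (sqrtOp L g)

/-- The form of `L` is a Dirichlet form: the unit contraction operates on it. (Being the form of
a non-negative self-adjoint operator, it is densely defined, symmetric, non-negative and
closed.) -/
def IsDirichlet (L : Lp ℝ 2 μ →ₗ.[ℝ] Lp ℝ 2 μ) : Prop :=
  ∀ f : (sqrtOp L).domain, ∃ g : (sqrtOp L).domain,
    ((g : Lp ℝ 2 μ) =ᵐ[μ] fun x => max 0 (min ((f : Lp ℝ 2 μ) x) 1)) ∧ form L g g ≤ form L f f

/-- Regularity: `D(E) ∩ C_c(X)` is dense in `D(E)` for the norm `(‖f‖² + E(f, f))^{1/2}` and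
dense in `C_c(X)` for the uniform norm. -/
structure IsRegular (L : Lp ℝ 2 μ →ₗ.[ℝ] Lp ℝ 2 μ) : Prop where
  dense_domain : ∀ f : (sqrtOp L).domain, ∀ ε > 0,
    ∃ (φ : X → ℝ) (g : (sqrtOp L).domain), Continuous φ ∧ HasCompactSupport φ ∧
      ((g : Lp ℝ 2 μ) =ᵐ[μ] φ) ∧
      ‖(f : Lp ℝ 2 μ) - g‖ ^ 2 + form L (f - g) (f - g) < ε
  dense_continuous : ∀ ψ : X → ℝ, Continuous ψ → HasCompactSupport ψ → ∀ ε > 0,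
    ∃ (φ : X → ℝ) (g : (sqrtOp L).domain), Continuous φ ∧ HasCompactSupport φ ∧
      ((g : Lp ℝ 2 μ) =ᵐ[μ] φ) ∧ ∀ x, |ψ x - φ x| < ε

/-- Strong locality: `E(f, g) = 0` whenever `f, g ∈ D(E)` have compact support and `g` is constant
on a neighbourhood `U` of the support of `f`. -/
def IsStronglyLocal (L : Lp ℝ 2 μ →ₗ.[ℝ] Lp ℝ 2 μ) : Prop :=
  ∀ (f g : (sqrtOp L).domain) (K K' U : Set X) (c : ℝ),
    IsCompact K → IsCompact K' → IsOpen U → K ⊆ U →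
    (∀ᵐ x ∂μ, x ∉ K → (f : Lp ℝ 2 μ) x = 0) →
    (∀ᵐ x ∂μ, x ∉ K' → (g : Lp ℝ 2 μ) x = 0) →
    (∀ᵐ x ∂μ, x ∈ U → (g : Lp ℝ 2 μ) x = c) →
    form L f g = 0

/-- `m` is the energy measure `dΓ(f, f)` of a bounded `f ∈ D(E)`: the finite Borel measure with
`∫ φ dΓ(f, f) = E(f, fφ) - (1/2) E(f², φ)` for all `φ ∈ D(E) ∩ C_c(X)`. (Products of bounded
functions in the domain of a Dirichlet form are again in the domain.) -/
def IsBddEnergyMeasure (L : Lp ℝ 2 μ →ₗ.[ℝ] Lp ℝ 2 μ) (f : (sqrtOp L).domain)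
    (m : Measure X) : Prop :=
  IsFiniteMeasure m ∧
    ∀ (φ : X → ℝ) (p : (sqrtOp L).domain), Continuous φ → HasCompactSupport φ →
      ((p : Lp ℝ 2 μ) =ᵐ[μ] φ) →
      ∃ u v : (sqrtOp L).domain,
        ((u : Lp ℝ 2 μ) =ᵐ[μ] fun x => (f : Lp ℝ 2 μ) x * φ x) ∧
        ((v : Lp ℝ 2 μ) =ᵐ[μ] fun x => ((f : Lp ℝ 2 μ) x) ^ 2) ∧
        ∫ x, φ x ∂m = form L f u - (1 / 2) * form L v p

/-- `m` is the energy measure `dΓ(f, f)` of `f ∈ D(E)`: the finite Borel measure which is the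
setwise limit of the energy measures of the truncations `(-n) ∨ (f ∧ n)`. -/
def IsEnergyMeasure (L : Lp ℝ 2 μ →ₗ.[ℝ] Lp ℝ 2 μ) (f : Lp ℝ 2 μ) (m : Measure X) : Prop :=
  f ∈ (sqrtOp L).domain ∧ IsFiniteMeasure m ∧
    ∃ (g : ℕ → (sqrtOp L).domain) (ν : ℕ → Measure X),
      (∀ n : ℕ, ((g n : Lp ℝ 2 μ) =ᵐ[μ] fun x => max (-(n : ℝ)) (min (f x) n)) ∧
        IsBddEnergyMeasure L (g n) (ν n)) ∧
      ∀ A : Set X, MeasurableSet A → Tendsto (fun n => ν n A) atTop (𝓝 (m A))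

open scoped Classical in
/-- The energy measure `dΓ(f, f)` of `f ∈ D(E)` (it exists and is unique if `E` is a regular
Dirichlet form; a default value otherwise). -/
def energyMeasure (L : Lp ℝ 2 μ →ₗ.[ℝ] Lp ℝ 2 μ) (f : Lp ℝ 2 μ) : Measure X :=
  if h : ∃ m : Measure X, IsEnergyMeasure L f m then h.choose else 0

/-- The local Poincaré inequality with constant `C`, for all balls of radius less than `r₀` and
all `f ∈ D(L)`. -/
def LocalPoincare (L : Lp ℝ 2 μ →ₗ.[ℝ] Lp ℝ 2 μ) (C r₀ : ℝ) : Prop :=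
  ∀ f ∈ L.domain, ∀ (x : X) (r : ℝ), 0 < r → r < r₀ →
    ∫ y in ball x r, (f y - ⨍ z in ball x r, f z ∂μ) ^ 2 ∂μ ≤
      C * r ^ 2 * (energyMeasure L f).real (ball x r)

end Spaces

end GlobalPoincare

end

/-! Write `S` for the square root of `L` and `E` for the form. The lattice comes from a maximal
disjoint family of balls of radius `ρ / 2`; doubling bounds its multiplicity by `8 ^ D`.

For the inequality, take first `f` in the domain of `L`. On each ball `B` of the lattice, the
integral of `f²` is the variance of `f` plus `|⟨f, ξ⟩|²` (`setIntegral_sq_eq`), and the local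
Poincaré inequality bounds the variance by `C ρ² Γ(B)`. The balls cover `X` with multiplicity at
most `N`, so summation gives `‖f‖² ≤ C N ρ² Γ(X) + ∑ |⟨f, ξ⟩|²`.

The analytic point is `Γ(X) ≤ ‖S f‖²`. The resolvents `J = (1 + ε S²)⁻¹` are sub-Markov because the
unit contraction operates on the form, and `ε⁻¹ ⟨f - J f, g⟩ → E(f, g)` as `ε → 0`. For fixed `ε`,
the expression defining the energy measure is the integral of `φ` against a non-negative density of
mass at most `⟨f - J f, f⟩` (`IsSubMarkov.energy_le`). In the limit, `∫ φ dΓ ≤ c E(f, f)` for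
bounded `f` and `φ ≤ c` with `c ≥ 0`; exhaustion by compact sets and truncation finish the bound.

General `f` are approximated in graph norm by elements of the domain of `L`. The coefficient sums
are compared by Young's inequality, which is where `α` enters (`tsum_sq_coeff_le`). -/

namespace GlobalPoincare

/-! ### Lattices in doubling spaces -/

section Lattice

variable {X : Type*} [MetricSpace X] [MeasurableSpace X] {μ : Measure X}

theorem IsDoubling.measure_ball_pos {D : ℝ} (h : IsDoubling μ D) (x : X) {r : ℝ} (hr : 0 < r) :
    0 < μ (ball x r) := by
  have := (h x (r / 2) (by positivity)).1
  rwa [mul_div_cancel₀ r two_ne_zero] at this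

theorem IsDoubling.measure_ball_pow_mul_le {D : ℝ} (h : IsDoubling μ D) (x : X) {r : ℝ}
    (hr : 0 < r) (k : ℕ) :
    μ (ball x (2 ^ k * r)) ≤ ((2 : ℝ≥0∞) ^ D) ^ k * μ (ball x r) := by
  induction k with
  | zero => simp
  | succ k ih =>
    calc μ (ball x (2 ^ (k + 1) * r)) = μ (ball x (2 * (2 ^ k * r))) := by
          rw [pow_succ, mul_comm _ (2 : ℝ), mul_assoc]
      _ ≤ (2 : ℝ≥0∞) ^ D * μ (ball x (2 ^ k * r)) := (h x _ (by positivity)).2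
      _ ≤ (2 : ℝ≥0∞) ^ D * (((2 : ℝ≥0∞) ^ D) ^ k * μ (ball x r)) := by gcongr
      _ = _ := by rw [pow_succ]; ring

theorem IsDoubling.measure_ball_lt_top [IsLocallyFiniteMeasure μ] {D : ℝ}
    (h : IsDoubling μ D) (hD : 0 < D) (x : X) (r : ℝ) : μ (ball x r) < ∞ := by
  obtain ⟨δ, hδ, hfin⟩ : ∃ δ > 0, μ (ball x δ) < ∞ := by
    obtain ⟨s, hs, hfin⟩ := μ.finiteAt_nhds x
    obtain ⟨δ, hδ, hsub⟩ := Metric.mem_nhds_iff.1 hs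
    exact ⟨δ, hδ, (measure_mono hsub).trans_lt hfin⟩
  obtain ⟨k, hk⟩ := pow_unbounded_of_one_lt (r / δ) (one_lt_two (α := ℝ))
  have h2 : (2 : ℝ≥0∞) ^ D < ∞ := ENNReal.rpow_lt_top_of_nonneg hD.le (by simp)
  calc μ (ball x r) ≤ μ (ball x (2 ^ k * δ)) :=
        measure_mono (ball_subset_ball ((div_lt_iff₀ hδ).1 hk).le)
    _ ≤ ((2 : ℝ≥0∞) ^ D) ^ k * μ (ball x δ) := h.measure_ball_pow_mul_le x hδ k
    _ < ∞ := ENNReal.mul_lt_top (ENNReal.pow_lt_top h2) hfin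

/-- A maximal family of disjoint balls of radius `ρ / 2`. -/
theorem exists_pairwiseDisjoint_ball_cover (X : Type*) [MetricSpace X] {ρ : ℝ} (hρ : 0 < ρ) :
    ∃ Λ : Set X, Λ.PairwiseDisjoint (fun p => ball p (ρ / 2)) ∧
      ⋃ p ∈ Λ, ball p ρ = Set.univ := by
  obtain ⟨Λ, hΛ⟩ := zorn_subset {Λ : Set X | Λ.PairwiseDisjoint (fun p => ball p (ρ / 2))} (by
    intro c hc hchain
    refine ⟨⋃₀ c, ?_, fun s hs => Set.subset_sUnion_of_mem hs⟩
    exact (Set.pairwiseDisjoint_sUnion hchain.directedOn).2 fun s hs => hc hs)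
  refine ⟨Λ, hΛ.prop, Set.eq_univ_of_forall fun x => ?_⟩
  by_contra hx
  simp only [Set.mem_iUnion, mem_ball, exists_prop, not_exists, not_and, not_lt] at hx
  have hins : (insert x Λ).PairwiseDisjoint (fun p => ball p (ρ / 2)) := by
    refine hΛ.prop.insert fun p hp _ => ball_disjoint_ball ?_
    linarith [hx p hp]
  have hxΛ : x ∈ Λ := hΛ.le_of_ge hins (Set.subset_insert x Λ) (Set.mem_insert x Λ)
  have := hx x hxΛ
  rw [dist_self] at this
  linarith

/-- In a doubling space at most `8 ^ D` of the balls of radius `ρ` of a lattice meet at a point. -/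
theorem card_le_of_pairwiseDisjoint_ball [OpensMeasurableSpace X] [IsLocallyFiniteMeasure μ]
    {D : ℝ} (h : IsDoubling μ D) (hD : 0 < D) {ρ : ℝ} (hρ : 0 < ρ) (x : X) (s : Finset X)
    (hs : (s : Set X).PairwiseDisjoint (fun p => ball p (ρ / 2)))
    (hx : ∀ p ∈ s, x ∈ ball p ρ) : (s.card : ℝ) ≤ (8 : ℝ) ^ D := by
  set V := μ (ball x (3 / 2 * ρ)) with hV
  have hV0 : V ≠ 0 := (h.measure_ball_pos x (by positivity)).ne'
  have hVtop : V ≠ ∞ := (h.measure_ball_lt_top hD x _).ne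
  -- `B(x, 3ρ/2)` lies in `B(p, 5ρ/2)`, hence in `B(p, 4ρ)`, and `4ρ` is three doublings of `ρ / 2`:
  -- this produces `8 ^ D`.
  have hlow : ∀ p ∈ s, V ≤ (8 : ℝ≥0∞) ^ D * μ (ball p (ρ / 2)) := by
    intro p hp
    have hxp : dist x p < ρ := hx p hp
    calc V ≤ μ (ball p (2 ^ 3 * (ρ / 2))) := by
          refine measure_mono (ball_subset_ball' ?_)
          linarith
      _ ≤ ((2 : ℝ≥0∞) ^ D) ^ 3 * μ (ball p (ρ / 2)) :=
          h.measure_ball_pow_mul_le p (by positivity) 3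
      _ = _ := by
          rw [← ENNReal.rpow_natCast, ← ENNReal.rpow_mul, mul_comm D, ENNReal.rpow_mul,
            ENNReal.rpow_natCast]
          norm_num
  have hsum : ∑ p ∈ s, μ (ball p (ρ / 2)) ≤ V := by
    rw [← measure_biUnion_finset hs fun p _ => measurableSet_ball]
    refine measure_mono (Set.iUnion₂_subset fun p hp => ball_subset_ball' ?_)
    have hxp : dist x p < ρ := hx p hp
    rw [dist_comm] at hxp
    linarith
  have hkey : (s.card : ℝ≥0∞) * V ≤ (8 : ℝ≥0∞) ^ D * V :=
    calc (s.card : ℝ≥0∞) * V = ∑ _p ∈ s, V := by simp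
      _ ≤ ∑ p ∈ s, (8 : ℝ≥0∞) ^ D * μ (ball p (ρ / 2)) := Finset.sum_le_sum hlow
      _ = (8 : ℝ≥0∞) ^ D * ∑ p ∈ s, μ (ball p (ρ / 2)) := by rw [Finset.mul_sum]
      _ ≤ (8 : ℝ≥0∞) ^ D * V := by gcongr
  have hcard : (s.card : ℝ≥0∞) ≤ (8 : ℝ≥0∞) ^ D := (ENNReal.mul_le_mul_iff_left hV0 hVtop).1 hkey
  have h8 : (8 : ℝ≥0∞) ^ D = ENNReal.ofReal ((8 : ℝ) ^ D) := by
    rw [← ENNReal.ofReal_rpow_of_pos (by norm_num)]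
    norm_num
  rw [h8, ← ENNReal.ofReal_natCast] at hcard
  exact (ENNReal.ofReal_le_ofReal_iff (by positivity)).1 hcard

theorem exists_isLattice [OpensMeasurableSpace X] [IsLocallyFiniteMeasure μ]
    {D : ℝ} (h : IsDoubling μ D) (hD : 0 < D) {ρ : ℝ} (hρ : 0 < ρ) :
    ∃ Λ : Set X, IsLattice ⌊(8 : ℝ) ^ D⌋₊ ρ Λ := by
  obtain ⟨Λ, hdisj, hcov⟩ := exists_pairwiseDisjoint_ball_cover X hρ
  refine ⟨Λ, hdisj, hcov, fun x => ?_⟩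
  by_contra! hlt
  obtain ⟨t, ht, htcard⟩ := Set.exists_subset_encard_eq (Order.add_one_le_of_lt hlt)
  have htfin : t.Finite :=
    Set.finite_of_encard_eq_coe (k := ⌊(8 : ℝ) ^ D⌋₊ + 1) (by simpa using htcard)
  lift t to Finset X using htfin
  rw [Set.encard_coe_eq_coe_finsetCard] at htcard
  have hc : t.card = ⌊(8 : ℝ) ^ D⌋₊ + 1 := by exact_mod_cast htcard
  have := card_le_of_pairwiseDisjoint_ball h hD hρ x t (hdisj.subset fun p hp => (ht hp).1)
    fun p hp => (ht hp).2
  rw [hc] at this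
  push_cast at this
  linarith [Nat.lt_floor_add_one ((8 : ℝ) ^ D)]

theorem IsLattice.countable {X : Type*} [MetricSpace X] [TopologicalSpace.SeparableSpace X]
    {N : ℕ} {ρ : ℝ} {Λ : Set X}
    (h : IsLattice N ρ Λ) (hρ : 0 < ρ) : Λ.Countable :=
  h.disjoint.countable_of_isOpen (fun _ _ => isOpen_ball)
    fun p _ => ⟨p, mem_ball_self (by positivity)⟩

theorem IsLattice.measure_univ_le_tsum [TopologicalSpace.SeparableSpace X] {N : ℕ} {ρ : ℝ}
    {Λ : Set X} (h : IsLattice N ρ Λ) (hρ : 0 < ρ) (m : Measure X) :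
    m Set.univ ≤ ∑' p : Λ, m (ball (p : X) ρ) := by
  have := (h.countable hρ).to_subtype
  rw [← h.cover, Set.biUnion_eq_iUnion]
  exact measure_iUnion_le _

/-- The indicators of the balls add up to at most `N` at every point; integrate by Tonelli. -/
theorem IsLattice.tsum_measure_le [OpensMeasurableSpace X] [TopologicalSpace.SeparableSpace X]
    {N : ℕ} {ρ : ℝ} {Λ : Set X} (h : IsLattice N ρ Λ) (hρ : 0 < ρ) (m : Measure X) :
    ∑' p : Λ, m (ball (p : X) ρ) ≤ N * m Set.univ := by
  have := (h.countable hρ).to_subtype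
  calc ∑' p : Λ, m (ball (p : X) ρ)
      = ∑' p : Λ, ∫⁻ x, (ball (p : X) ρ).indicator 1 x ∂m := by
        congr! 2 with p
        rw [lintegral_indicator_one measurableSet_ball]
    _ = ∫⁻ x, ∑' p : Λ, (ball (p : X) ρ).indicator 1 x ∂m :=
        (lintegral_tsum fun p => (measurable_one.indicator measurableSet_ball).aemeasurable).symm
    _ ≤ ∫⁻ _x, N ∂m := by
        refine lintegral_mono fun x => ?_
        have hsum : ∑' p : Λ, (ball (p : X) ρ).indicator (1 : X → ℝ≥0∞) x
            = ({p : Λ | x ∈ ball (p : X) ρ}.encard : ℝ≥0∞) := by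
          rw [← ENNReal.tsum_set_one, tsum_subtype {p : Λ | x ∈ ball (p : X) ρ} fun _ => (1 : ℝ≥0∞)]
          rfl
        have henc : {p : Λ | x ∈ ball (p : X) ρ}.encard ≤ {p ∈ Λ | x ∈ ball p ρ}.encard := by
          rw [← Subtype.val_injective.encard_image]
          refine Set.encard_le_encard ?_
          rintro _ ⟨p, hp, rfl⟩
          exact ⟨p.2, hp⟩
        dsimp only
        rw [hsum]
        exact_mod_cast henc.trans (h.multiplicity x)
    _ = N * m Set.univ := by rw [lintegral_const]

end Lattice


/-! ### Resolvents of `S²` for a self-adjoint `S` -/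

section Resolvent

variable {H : Type*} [NormedAddCommGroup H] [InnerProductSpace ℝ H] [CompleteSpace H]
  {S : H →ₗ.[ℝ] H}

theorem graph_symm (hS : IsSelfAdjoint S) {a b c d : H} (h₁ : (a, b) ∈ S.graph)
    (h₂ : (c, d) ∈ S.graph) : inner ℝ b c = inner ℝ a d := by
  rw [← LinearPMap.isSelfAdjoint_def.1 hS,
    LinearPMap.adjoint_graph_eq_graph_adjoint hS.dense_domain, Submodule.mem_adjoint_iff] at h₁
  have := h₁ c d h₂
  simp only [sub_eq_zero] at this
  rw [real_inner_comm, ← this, real_inner_comm]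

/-- Since `S` equals its adjoint, a weak identity tested on the graph already gives membership. -/
theorem mem_graph_of_forall_inner_eq (hS : IsSelfAdjoint S) {g k : H}
    (h : ∀ w z, (w, z) ∈ S.graph → inner ℝ k w = inner ℝ g z) : (g, k) ∈ S.graph := by
  rw [← LinearPMap.isSelfAdjoint_def.1 hS,
    LinearPMap.adjoint_graph_eq_graph_adjoint hS.dense_domain, Submodule.mem_adjoint_iff]
  intro w z hwz
  rw [real_inner_comm, ← h w z hwz, real_inner_comm, sub_self]

/-- `J` is the resolvent `(1 + ε S²)⁻¹`. -/
def IsResolvent (S : H →ₗ.[ℝ] H) (ε : ℝ) (J : H →ₗ[ℝ] H) : Prop :=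
  ∀ h, ∃ g, (J h, g) ∈ S.graph ∧ (g, ε⁻¹ • (h - J h)) ∈ S.graph

/-- Project `(h, 0)` orthogonally onto the closed subspace of pairs `(u, √ε S u)`. Orthogonality to
all `(w, √ε S w)` reads `⟨h - u, w⟩ = ε ⟨S u, S w⟩`, which puts `S u` in the domain of the adjoint
of `S`. No spectral theorem is needed. -/
theorem exists_graph_graph (hS : IsSelfAdjoint S) {ε : ℝ} (hε : 0 < ε) (h : H) :
    ∃ u g, (u, g) ∈ S.graph ∧ (g, ε⁻¹ • (h - u)) ∈ S.graph := by
  set c := √ε with hc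
  have hc0 : c ≠ 0 := (Real.sqrt_pos.2 hε).ne'
  have hcc : c * c = ε := Real.mul_self_sqrt hε.le
  let T : WithLp 2 (H × H) →ₗ[ℝ] H × H :=
    { toFun := fun z => (z.fst, c⁻¹ • z.snd)
      map_add' := fun x y => by simp
      map_smul' := fun r x => by simp [smul_comm c⁻¹ r] }
  let K : Submodule ℝ (WithLp 2 (H × H)) := S.graph.comap T
  have hK : IsClosed (K : Set (WithLp 2 (H × H))) := by
    have hT : Continuous T := by
      change Continuous fun z : WithLp 2 (H × H) => (z.fst, c⁻¹ • z.snd)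
      fun_prop
    exact (hS.isClosed : IsClosed (S.graph : Set (H × H))).preimage hT
  have : CompleteSpace K := hK.completeSpace_coe
  obtain ⟨k, hkK, hk⟩ : ∃ k ∈ K, ∀ w ∈ K, inner ℝ (WithLp.toLp 2 (h, (0 : H)) - k) w = 0 := by
    refine ⟨K.starProjection (WithLp.toLp 2 (h, 0)), K.starProjection_apply_mem _, fun w hw => ?_⟩
    exact K.starProjection_inner_eq_zero _ w hw
  refine ⟨k.fst, c⁻¹ • k.snd, hkK, mem_graph_of_forall_inner_eq hS fun w z hwz => ?_⟩
  have := hk (WithLp.toLp 2 (w, c • z)) (by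
    change (w, c⁻¹ • (c • z)) ∈ S.graph
    rwa [inv_smul_smul₀ hc0])
  rw [WithLp.prod_inner_apply] at this
  change inner ℝ (h - k.fst) w + inner ℝ (0 - k.snd) (c • z) = 0 at this
  rw [zero_sub, inner_neg_left, inner_smul_right] at this
  rw [inner_smul_left, inner_smul_left]
  simp only [map_inv₀, conj_trivial]
  rw [← hcc]
  field_simp
  linarith

theorem exists_isResolvent (hS : IsSelfAdjoint S) {ε : ℝ} (hε : 0 < ε) :
    ∃ J, IsResolvent S ε J := by
  choose u g hu hg using exists_graph_graph hS hε
  -- If `S² a = -ε⁻¹ a`, then `‖S a‖² = -ε⁻¹ ‖a‖²`, so `a = 0`. This uniqueness makes the chosen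
  -- solution linear in `h`.
  have uniq : ∀ a b, (a, b) ∈ S.graph → (b, -(ε⁻¹ • a)) ∈ S.graph → a = 0 := by
    intro a b h₁ h₂
    have h := graph_symm hS h₁ h₂
    rw [inner_neg_right, inner_smul_right, real_inner_self_eq_norm_sq,
      real_inner_self_eq_norm_sq] at h
    have : ε⁻¹ * ‖a‖ ^ 2 = 0 := le_antisymm (by nlinarith [sq_nonneg ‖b‖]) (by positivity)
    simpa [hε.ne'] using this
  refine ⟨{ toFun := u, map_add' := fun x y => ?_, map_smul' := fun r x => ?_ },
    fun h => ⟨g h, hu h, hg h⟩⟩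
  · refine sub_eq_zero.1 (uniq _ (g (x + y) - (g x + g y))
      (S.graph.sub_mem (hu _) (S.graph.add_mem (hu _) (hu _))) ?_)
    convert S.graph.sub_mem (hg (x + y)) (S.graph.add_mem (hg x) (hg y)) using 1
    ext
    · rfl
    · simp only [Prod.mk_add_mk, Prod.mk_sub_mk]
      module
  · refine sub_eq_zero.1 (uniq _ (g (r • x) - r • g x)
      (S.graph.sub_mem (hu _) (S.graph.smul_mem r (hu _))) ?_)
    convert S.graph.sub_mem (hg (r • x)) (S.graph.smul_mem r (hg x)) using 1
    ext
    · rfl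
    · simp only [RingHom.id_apply, Prod.smul_mk, Prod.mk_sub_mk]
      module

variable {ε : ℝ} {J : H →ₗ[ℝ] H}

theorem IsResolvent.symm (hJ : IsResolvent S ε J) (hS : IsSelfAdjoint S) (hε : 0 < ε)
    (f g : H) : inner ℝ (J f) g = inner ℝ f (J g) := by
  obtain ⟨a, ha, ha'⟩ := hJ f
  obtain ⟨b, hb, hb'⟩ := hJ g
  have h₁ := graph_symm hS ha hb'
  have h₂ := graph_symm hS ha' hb
  rw [inner_smul_right, inner_sub_right] at h₁
  rw [real_inner_smul_left, inner_sub_left, h₁] at h₂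
  have := mul_left_cancel₀ (inv_ne_zero hε.ne') h₂
  linarith

theorem IsResolvent.norm_sq_le (hJ : IsResolvent S ε J) (hS : IsSelfAdjoint S) (hε : 0 < ε)
    (f : H) : ‖J f‖ ^ 2 ≤ inner ℝ (J f) f := by
  obtain ⟨a, ha, ha'⟩ := hJ f
  have h := graph_symm hS ha ha'
  rw [inner_smul_right, inner_sub_right, real_inner_self_eq_norm_sq,
    real_inner_self_eq_norm_sq] at h
  have h0 : 0 ≤ ε * ‖a‖ ^ 2 := by positivity
  rw [h, mul_inv_cancel_left₀ hε.ne'] at h0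
  linarith

theorem IsResolvent.norm_le (hJ : IsResolvent S ε J) (hS : IsSelfAdjoint S) (hε : 0 < ε)
    (f : H) : ‖J f‖ ≤ ‖f‖ := by
  have h := (hJ.norm_sq_le hS hε f).trans (real_inner_le_norm (J f) f)
  rcases (norm_nonneg (J f)).eq_or_lt with h0 | h0
  · rw [← h0]; exact norm_nonneg f
  · rw [sq] at h
    exact le_of_mul_le_mul_left h h0

/-- The resolvent commutes with `S`. -/
theorem IsResolvent.mem_graph (hJ : IsResolvent S ε J) (hS : IsSelfAdjoint S) (hε : 0 < ε)
    {f f' : H} (hf : (f, f') ∈ S.graph) : (J f, J f') ∈ S.graph := by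
  refine mem_graph_of_forall_inner_eq hS fun w z hwz => ?_
  rw [hJ.symm hS hε, hJ.symm hS hε]
  obtain ⟨a, ha, ha'⟩ := hJ w
  -- For `c = S J w - J S w` one finds `S² c = -ε⁻¹ c`, so `c = 0`.
  have key : a = J z := by
    obtain ⟨b, hb, hb'⟩ := hJ z
    have hmem : (ε⁻¹ • (w - J w), ε⁻¹ • (z - a)) ∈ S.graph :=
      S.graph.smul_mem ε⁻¹ (S.graph.sub_mem hwz ha)
    set c := a - J z with hc
    have h₁ : (c, ε⁻¹ • (w - J w) - b) ∈ S.graph := S.graph.sub_mem ha' hb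
    have h₂ : (ε⁻¹ • (w - J w) - b, -(ε⁻¹ • c)) ∈ S.graph := by
      convert S.graph.sub_mem hmem hb' using 1
      ext
      · rfl
      · simp only [Prod.mk_sub_mk, hc]
        module
    have h := graph_symm hS h₁ h₂
    rw [inner_neg_right, inner_smul_right, real_inner_self_eq_norm_sq,
      real_inner_self_eq_norm_sq] at h
    have h3 : ε⁻¹ * ‖c‖ ^ 2 = 0 :=
      le_antisymm (by nlinarith [sq_nonneg ‖ε⁻¹ • (w - J w) - b‖]) (by positivity)
    have h4 : c = 0 := by simpa [hε.ne'] using h3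
    exact sub_eq_zero.1 h4
  rw [← key]
  exact graph_symm hS hf ha

/-- The left side is `⟨S² J f, g⟩ = ⟨S J f, S g⟩`, and `J` commutes with `S`. It is the bounded form
approximating `⟨S f, S g⟩`. -/
theorem IsResolvent.inner_sub (hJ : IsResolvent S ε J) (hS : IsSelfAdjoint S) (hε : 0 < ε)
    {f f' g g' : H} (hf : (f, f') ∈ S.graph) (hg : (g, g') ∈ S.graph) :
    ε⁻¹ * inner ℝ (f - J f) g = inner ℝ (J f') g' := by
  obtain ⟨a, ha, ha'⟩ := hJ f
  obtain rfl : a = J f' := S.mem_graph_snd_inj ha (hJ.mem_graph hS hε hf) rfl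
  rw [← real_inner_smul_left, graph_symm hS ha' hg]

theorem IsResolvent.norm_sub_sq_le (hJ : IsResolvent S ε J) (hS : IsSelfAdjoint S) (hε : 0 < ε)
    {f f' : H} (hf : (f, f') ∈ S.graph) : ‖f - J f‖ ^ 2 ≤ ε * ‖f'‖ ^ 2 := by
  have h := hJ.inner_sub hS hε hf (S.graph.sub_mem hf (hJ.mem_graph hS hε hf))
  rw [real_inner_self_eq_norm_sq, inner_sub_right, real_inner_self_eq_norm_sq] at h
  have h1 : inner ℝ (J f') f' ≤ ‖f'‖ ^ 2 :=
    (real_inner_le_norm _ _).trans (by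
      rw [sq]
      exact mul_le_mul_of_nonneg_right (hJ.norm_le hS hε f') (norm_nonneg _))
  rw [inv_mul_eq_div, div_eq_iff hε.ne'] at h
  nlinarith [mul_nonneg hε.le (sq_nonneg ‖J f'‖)]

/-- `J h` minimizes `‖v - h‖² + ε ‖S v‖²`, and completing the square makes the minimality
quantitative. The term `‖v - J h‖²` yields uniqueness of the minimizer. -/
theorem IsResolvent.variational (hJ : IsResolvent S ε J) (hS : IsSelfAdjoint S) (hε : 0 < ε)
    {h u' v v' : H} (hu : (J h, u') ∈ S.graph) (hv : (v, v') ∈ S.graph) :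
    ‖J h - h‖ ^ 2 + ε * ‖u'‖ ^ 2 + ‖v - J h‖ ^ 2 ≤ ‖v - h‖ ^ 2 + ε * ‖v'‖ ^ 2 := by
  obtain ⟨a, ha, ha'⟩ := hJ h
  obtain rfl : a = u' := S.mem_graph_snd_inj ha hu rfl
  have hi := graph_symm hS ha' (S.graph.sub_mem hv hu)
  simp only at hi
  rw [real_inner_smul_left, inv_mul_eq_div, div_eq_iff hε.ne'] at hi
  have h1 : ‖v - h‖ ^ 2 = ‖v - J h‖ ^ 2 - 2 * inner ℝ (h - J h) (v - J h) + ‖J h - h‖ ^ 2 := by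
    rw [show v - h = (v - J h) - (h - J h) by abel, norm_sub_sq_real, real_inner_comm,
      norm_sub_rev h]
  have h2 : ‖v'‖ ^ 2 = ‖v' - a‖ ^ 2 + 2 * inner ℝ a (v' - a) + ‖a‖ ^ 2 := by
    nth_rewrite 1 [show v' = (v' - a) + a by abel]
    rw [norm_add_sq_real, real_inner_comm]
  rw [h1, h2, hi]
  nlinarith [mul_nonneg hε.le (sq_nonneg ‖v' - a‖)]

theorem tendsto_resolvent {J : ℕ → H →ₗ[ℝ] H} {ε : ℕ → ℝ} (hS : IsSelfAdjoint S)
    (hε : ∀ n, 0 < ε n) (hε0 : Tendsto ε atTop (𝓝 0)) (hJ : ∀ n, IsResolvent S (ε n) (J n))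
    (f : H) : Tendsto (fun n => J n f) atTop (𝓝 f) := by
  rw [Metric.tendsto_atTop']
  intro δ hδ
  obtain ⟨w, hw, hfw⟩ := Metric.dense_iff.1 hS.dense_domain f (δ / 3) (by positivity)
  obtain ⟨w', hw'⟩ := LinearPMap.mem_domain_iff.1 hfw
  rw [mem_ball, dist_eq_norm] at hw
  have hlim : Tendsto (fun n => ε n * ‖w'‖ ^ 2) atTop (𝓝 0) := by
    simpa using hε0.mul_const (‖w'‖ ^ 2)
  obtain ⟨n₀, hn₀⟩ := eventually_atTop.1
    (hlim.eventually_lt_const (show 0 < (δ / 3) ^ 2 by positivity))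
  refine ⟨n₀, fun n hn => ?_⟩
  have h1 : ‖w - J n w‖ < δ / 3 :=
    lt_of_pow_lt_pow_left₀ 2 (by positivity)
      (((hJ n).norm_sub_sq_le hS (hε n) hw').trans_lt (hn₀ n hn.le))
  have h2 : ‖J n (f - w)‖ < δ / 3 := by
    refine ((hJ n).norm_le hS (hε n) _).trans_lt ?_
    rwa [norm_sub_rev]
  rw [dist_eq_norm]
  calc ‖J n f - f‖ = ‖J n (f - w) - (w - J n w) + (w - f)‖ := by
        rw [map_sub]; congr 1; abel
    _ ≤ ‖J n (f - w)‖ + ‖w - J n w‖ + ‖w - f‖ :=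
        (norm_add_le _ _).trans (add_le_add_left (norm_sub_le _ _) _)
    _ < δ := by linarith

theorem tendsto_resolvent_form {J : ℕ → H →ₗ[ℝ] H} {ε : ℕ → ℝ} (hS : IsSelfAdjoint S)
    (hε : ∀ n, 0 < ε n) (hε0 : Tendsto ε atTop (𝓝 0)) (hJ : ∀ n, IsResolvent S (ε n) (J n))
    {f f' g g' : H} (hf : (f, f') ∈ S.graph) (hg : (g, g') ∈ S.graph) :
    Tendsto (fun n => (ε n)⁻¹ * inner ℝ (f - J n f) g) atTop (𝓝 (inner ℝ f' g')) := by
  simp_rw [fun n => (hJ n).inner_sub hS (hε n) hf hg]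
  exact (tendsto_resolvent hS hε hε0 hJ f').inner tendsto_const_nhds

theorem exists_resolvent_seq (hS : IsSelfAdjoint S) :
    ∃ (ε : ℕ → ℝ) (J : ℕ → H →ₗ[ℝ] H), (∀ n, 0 < ε n) ∧ Tendsto ε atTop (𝓝 0) ∧
      ∀ n, IsResolvent S (ε n) (J n) := by
  choose J hJ using fun n : ℕ =>
    exists_isResolvent hS (ε := 1 / ((n : ℝ) + 1)) (by positivity)
  exact ⟨_, J, fun n => by positivity, tendsto_one_div_add_atTop_nhds_zero_nat, hJ⟩

/-- Either `sqrtOp A` is a non-negative square root of `A`, or it has its default value. The facts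
about `sqrtOp A` used below hold in both cases, so they need no existence theorem. -/
theorem sqrtOp_cases (A : H →ₗ.[ℝ] H) : IsNonnegSqrt A (sqrtOp A) ∨ sqrtOp A = 0 := by
  unfold sqrtOp
  split_ifs with h
  · exact Or.inl h.choose_spec
  · exact Or.inr rfl

theorem isSelfAdjoint_sqrtOp (A : H →ₗ.[ℝ] H) : IsSelfAdjoint (sqrtOp A) := by
  rcases sqrtOp_cases A with h | h
  · exact h.selfAdjoint
  · rw [h, LinearPMap.isSelfAdjoint_def]
    have hd : Dense ((0 : H →ₗ.[ℝ] H).domain : Set H) := by simp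
    have hle : (0 : H →ₗ.[ℝ] H) ≤ LinearPMap.adjoint (0 : H →ₗ.[ℝ] H) :=
      LinearPMap.IsFormalAdjoint.le_adjoint hd fun x y => by
        change inner ℝ (0 : H) (y : H) = inner ℝ (x : H) (0 : H)
        simp
    refine (LinearPMap.eq_of_le_of_domain_eq hle ?_).symm
    exact le_antisymm hle.1 le_top

/-- The domain of `A` is a core of `A^{1/2}`. -/
theorem exists_seq_mem_domain_tendsto {A : H →ₗ.[ℝ] H} (hA : IsSelfAdjoint A) {f f' : H}
    (hf : (f, f') ∈ (sqrtOp A).graph) :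
    ∃ g g' : ℕ → H, (∀ n, g n ∈ A.domain ∧ (g n, g' n) ∈ (sqrtOp A).graph) ∧
      Tendsto g atTop (𝓝 f) ∧ Tendsto g' atTop (𝓝 f') := by
  rcases sqrtOp_cases A with h | h
  · have hS := h.selfAdjoint
    obtain ⟨ε, J, hε, hε0, hJ⟩ := exists_resolvent_seq hS
    refine ⟨fun n => J n f, fun n => J n f', fun n => ⟨?_, (hJ n).mem_graph hS (hε n) hf⟩,
      tendsto_resolvent hS hε hε0 hJ f, tendsto_resolvent hS hε hε0 hJ f'⟩
    obtain ⟨a, ha, ha'⟩ := hJ n f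
    exact LinearPMap.mem_domain_of_mem_graph ((h.square _ _).2 ⟨a, ha, ha'⟩)
  · have hzero : ∀ x, (x, (0 : H)) ∈ (sqrtOp A).graph := fun x => by
      rw [h]; exact (0 : H →ₗ.[ℝ] H).mem_graph ⟨x, trivial⟩
    obtain rfl : f' = 0 := (sqrtOp A).mem_graph_snd_inj hf (hzero f) rfl
    obtain ⟨g, hg, hlim⟩ := mem_closure_iff_seq_limit.1 (hA.dense_domain f)
    exact ⟨g, fun _ => 0, fun n => ⟨hg n, hzero _⟩, hlim, tendsto_const_nhds⟩

end Resolvent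


/-! ### Sub-Markov operators and the Markov property of the resolvent -/

section SubMarkov

variable {X : Type*} [MeasurableSpace X] {μ : Measure X}

theorem inner_eq_integral_mul (f g : Lp ℝ 2 μ) : inner ℝ f g = ∫ x, f x * g x ∂μ := by
  rw [L2.inner_def]
  simp [mul_comm]

theorem integrable_mul_Lp (f g : Lp ℝ 2 μ) : Integrable (fun x => f x * g x) μ :=
  (Lp.memLp f).integrable_mul (Lp.memLp g)

/-- A symmetric contraction of `L²` which preserves lower bounds by non-positive constants. -/
structure IsSubMarkov (A : Lp ℝ 2 μ →ₗ[ℝ] Lp ℝ 2 μ) : Prop where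
  symm : ∀ f g, inner ℝ (A f) g = inner ℝ f (A g)
  norm_le : ∀ f, ‖A f‖ ≤ ‖f‖
  lower : ∀ (f : Lp ℝ 2 μ) (k : ℝ), 0 ≤ k → (∀ᵐ x ∂μ, -k ≤ f x) → ∀ᵐ x ∂μ, -k ≤ A f x

theorem IsSubMarkov.upper {A : Lp ℝ 2 μ →ₗ[ℝ] Lp ℝ 2 μ} (hA : IsSubMarkov A) (f : Lp ℝ 2 μ)
    (k : ℝ) (hk : 0 ≤ k) (hf : ∀ᵐ x ∂μ, f x ≤ k) : ∀ᵐ x ∂μ, A f x ≤ k := by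
  have h := hA.lower (-f) k hk (by
    filter_upwards [hf, Lp.coeFn_neg f] with x h₁ h₂
    rw [h₂, Pi.neg_apply]
    linarith)
  rw [map_neg] at h
  filter_upwards [h, Lp.coeFn_neg (A f)] with x h₁ h₂
  rw [h₂, Pi.neg_apply] at h₁
  linarith

theorem inner_sub_self_nonneg {H : Type*} [NormedAddCommGroup H] [InnerProductSpace ℝ H]
    {A : H →ₗ[ℝ] H} (hA : ∀ f, ‖A f‖ ≤ ‖f‖) (f : H) : 0 ≤ inner ℝ (f - A f) f := by
  rw [inner_sub_left, real_inner_self_eq_norm_mul_norm]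
  have := (real_inner_le_norm (A f) f).trans
    (mul_le_mul_of_nonneg_right (hA f) (norm_nonneg f))
  linarith

/-- Truncation decreases the approximating forms. -/
theorem IsSubMarkov.inner_truncation_le {A : Lp ℝ 2 μ →ₗ[ℝ] Lp ℝ 2 μ} (hA : IsSubMarkov A)
    {f g : Lp ℝ 2 μ} {k : ℝ} (hk : 0 ≤ k) (hg : g =ᵐ[μ] fun x => max (-k) (min (f x) k)) :
    inner ℝ (g - A g) g ≤ inner ℝ (f - A f) f := by
  obtain ⟨h, rfl⟩ : ∃ h, f = g + h := ⟨f - g, by abel⟩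
  -- The remainder `h` vanishes except where `g = k` (there `h ≥ 0`) or `g = -k` (there `h ≤ 0`),
  -- and `|A g| ≤ k`, so `g - A g` has the sign of `h`.
  have hcross : 0 ≤ inner ℝ (g - A g) h := by
    rw [inner_eq_integral_mul]
    refine integral_nonneg_of_ae ?_
    have hlow : ∀ᵐ x ∂μ, -k ≤ g x := by
      filter_upwards [hg] with x hx
      rw [hx]
      exact le_max_left _ _
    have hup : ∀ᵐ x ∂μ, g x ≤ k := by
      filter_upwards [hg] with x hx
      rw [hx]
      exact max_le (by linarith) (min_le_right _ _)
    filter_upwards [hg, hA.lower g k hk hlow, hA.upper g k hk hup, Lp.coeFn_sub g (A g),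
      Lp.coeFn_add g h] with x h₁ h₂ h₃ h₄ h₅
    rw [h₄, Pi.zero_apply, Pi.sub_apply]
    rw [h₅, Pi.add_apply] at h₁
    rcases lt_trichotomy (h x) 0 with hx | hx | hx
    · have : g x = -k := by
        rcases max_cases (-k) (min (g x + h x) k) with hm | hm
        · linarith
        · have := min_le_left (g x + h x) k
          linarith
      exact mul_nonneg_of_nonpos_of_nonpos (by linarith) hx.le
    · simp [hx]
    · have : g x = k := by
        rcases max_cases (-k) (min (g x + h x) k) with hm | hm
        · have := hm.2
          rcases min_cases (g x + h x) k with hm' | hm' <;> linarith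
        · rcases min_cases (g x + h x) k with hm' | hm' <;> linarith
      exact mul_nonneg (by linarith) hx.le
  have hh := inner_sub_self_nonneg hA.norm_le h
  have hexp : inner ℝ (g + h - A (g + h)) (g + h)
      = inner ℝ (g - A g) g + 2 * inner ℝ (g - A g) h + inner ℝ (h - A h) h := by
    have h1 := hA.symm h g
    have h2 := real_inner_comm h g
    have h3 := real_inner_comm h (A g)
    simp only [map_add, inner_sub_left, inner_add_left, inner_add_right]
    have h4 := real_inner_comm (A g) h
    linarith
  linarith

/-- Jensen's inequality: `f² - 2 c f ≥ -c²` is preserved by `A`. Rational `c` keep the exceptional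
set null; by density one may then take `c = A f x`. The constant stays a lower bound because it need
not lie in `L²`. -/
theorem IsSubMarkov.sq_le {A : Lp ℝ 2 μ →ₗ[ℝ] Lp ℝ 2 μ} (hA : IsSubMarkov A)
    {f v : Lp ℝ 2 μ} (hv : v =ᵐ[μ] fun x => f x ^ 2) : ∀ᵐ x ∂μ, A f x ^ 2 ≤ A v x := by
  have hq : ∀ c : ℚ, ∀ᵐ x ∂μ, 2 * c * A f x - (c : ℝ) ^ 2 ≤ A v x := by
    intro c
    have h := hA.lower (v - (2 * c : ℝ) • f) ((c : ℝ) ^ 2) (sq_nonneg _) (by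
      filter_upwards [hv, Lp.coeFn_sub v ((2 * c : ℝ) • f), Lp.coeFn_smul (2 * c : ℝ) f]
        with x h₁ h₂ h₃
      rw [h₂, Pi.sub_apply, h₃, h₁, Pi.smul_apply, smul_eq_mul]
      nlinarith [sq_nonneg (f x - c)])
    rw [map_sub, map_smul] at h
    filter_upwards [h, Lp.coeFn_sub (A v) ((2 * c : ℝ) • A f),
      Lp.coeFn_smul (2 * c : ℝ) (A f)] with x h₁ h₂ h₃
    rw [h₂, Pi.sub_apply, h₃, Pi.smul_apply, smul_eq_mul] at h₁
    linarith
  filter_upwards [ae_all_iff.2 hq] with x hx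
  have hreal : ∀ c : ℝ, 2 * c * A f x - c ^ 2 ≤ A v x := by
    intro c
    refine Rat.denseRange_cast.induction_on (p := fun c : ℝ => 2 * c * A f x - c ^ 2 ≤ A v x) c
      (isClosed_le (by fun_prop) continuous_const) hx
  have := hreal (A f x)
  linarith

/-- By symmetry, the integral of `A v` over a set of finite measure is the pairing of `v` with the
image of an indicator, and that image is at most `1`. -/
theorem IsSubMarkov.integral_le [SigmaFinite μ] {A : Lp ℝ 2 μ →ₗ[ℝ] Lp ℝ 2 μ}
    (hA : IsSubMarkov A) {v : Lp ℝ 2 μ} (hv0 : ∀ᵐ x ∂μ, 0 ≤ v x) (hv : Integrable v μ) :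
    Integrable (A v) μ ∧ ∫ x, A v x ∂μ ≤ ∫ x, v x ∂μ := by
  have hAv0 : ∀ᵐ x ∂μ, 0 ≤ A v x := by
    simpa using hA.lower v 0 le_rfl (by simpa using hv0)
  have hset : ∀ s, MeasurableSet s → μ s ≠ ∞ → ∫ x in s, A v x ∂μ ≤ ∫ x, v x ∂μ := by
    intro s hs hμs
    have h1 : ∀ᵐ x ∂μ, A (indicatorConstLp 2 hs hμs (1 : ℝ)) x ≤ 1 := by
      refine hA.upper _ 1 zero_le_one ?_
      filter_upwards [indicatorConstLp_coeFn (p := 2) (hs := hs) (hμs := hμs) (c := (1 : ℝ))]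
        with x hx
      rw [hx]
      exact Set.indicator_le_self' (by simp) x
    rw [← L2.inner_indicatorConstLp_one hs hμs, ← hA.symm, inner_eq_integral_mul]
    refine integral_mono_ae (integrable_mul_Lp _ _) hv ?_
    filter_upwards [h1, hv0] with x h₁ h₂
    exact mul_le_of_le_one_left h₂ h₁
  have hlset : ∀ s, MeasurableSet s → μ s ≠ ∞ →
      ∫⁻ x in s, ‖A v x‖ₑ ∂μ ≤ ENNReal.ofReal (∫ x, v x ∂μ) := by
    intro s hs hμs
    have hint : IntegrableOn (A v) s μ :=
      integrableOn_Lp_of_measure_ne_top _ (by norm_num) hμs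
    rw [← ofReal_integral_norm_eq_lintegral_enorm hint]
    refine ENNReal.ofReal_le_ofReal ((le_of_eq ?_).trans (hset s hs hμs))
    refine integral_congr_ae ?_
    filter_upwards [ae_restrict_of_ae hAv0] with x hx
    exact Real.norm_of_nonneg hx
  have hint : Integrable (A v) μ :=
    integrable_of_forall_fin_meas_le _ ENNReal.ofReal_lt_top (Lp.aestronglyMeasurable _) hlset
  refine ⟨hint, ?_⟩
  have h := lintegral_le_of_forall_fin_meas_le _ hlset
  rw [← ofReal_integral_norm_eq_lintegral_enorm hint,
    ENNReal.ofReal_le_ofReal_iff (integral_nonneg_of_ae hv0)] at h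
  refine (le_of_eq (integral_congr_ae ?_)).trans h
  filter_upwards [hAv0] with x hx
  exact (Real.norm_of_nonneg hx).symm

/-- The left side equals `∫ p e` with `e = v / 2 - f A f + A v / 2`. Jensen gives `e ≥ (f - A f)² /
2 ≥ 0`, and `∫ A v ≤ ∫ v` gives `∫ e ≤ ⟨f - A f, f⟩`. -/
theorem IsSubMarkov.energy_le [SigmaFinite μ] {A : Lp ℝ 2 μ →ₗ[ℝ] Lp ℝ 2 μ}
    (hA : IsSubMarkov A) {f u v p : Lp ℝ 2 μ} {c : ℝ} (hc : 0 ≤ c)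
    (hu : u =ᵐ[μ] fun x => f x * p x) (hv : v =ᵐ[μ] fun x => f x ^ 2)
    (hp : ∀ᵐ x ∂μ, p x ≤ c) :
    inner ℝ (f - A f) u - 1 / 2 * inner ℝ (v - A v) p ≤ c * inner ℝ (f - A f) f := by
  have hv0 : ∀ᵐ x ∂μ, 0 ≤ v x := by
    filter_upwards [hv] with x hx
    rw [hx]
    positivity
  have hfv : ∫ x, v x ∂μ = inner ℝ f f := by
    rw [inner_eq_integral_mul]
    refine integral_congr_ae ?_
    filter_upwards [hv] with x hx
    rw [hx, sq]
  have hvint : Integrable v μ :=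
    (Lp.memLp f).integrable_sq.congr (by filter_upwards [hv] with x hx using hx.symm)
  obtain ⟨hAvint, hAvle⟩ := hA.integral_le hv0 hvint
  set e : X → ℝ := fun x => 1 / 2 * v x - A f x * f x + 1 / 2 * A v x with he
  have he_int : Integrable e μ :=
    ((hvint.const_mul _).sub (integrable_mul_Lp _ _)).add (hAvint.const_mul _)
  have he0 : ∀ᵐ x ∂μ, 0 ≤ e x := by
    filter_upwards [hA.sq_le hv, hv] with x h₁ h₂
    simp only [he, h₂]
    nlinarith [sq_nonneg (f x - A f x)]
  have hpe : (fun x => (f - A f) x * u x - 1 / 2 * ((v - A v) x * p x))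
      =ᵐ[μ] fun x => p x * e x := by
    filter_upwards [hu, hv, Lp.coeFn_sub f (A f), Lp.coeFn_sub v (A v)] with x h₁ h₂ h₃ h₄
    rw [h₃, h₄, Pi.sub_apply, Pi.sub_apply, h₁]
    simp only [he, h₂]
    ring
  have hpe_int : Integrable (fun x => p x * e x) μ :=
    ((integrable_mul_Lp (f - A f) u).sub ((integrable_mul_Lp (v - A v) p).const_mul _)).congr hpe
  calc inner ℝ (f - A f) u - 1 / 2 * inner ℝ (v - A v) p
      = ∫ x, p x * e x ∂μ := by
        rw [inner_eq_integral_mul, inner_eq_integral_mul, ← integral_const_mul,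
          ← integral_sub (integrable_mul_Lp _ _) ((integrable_mul_Lp _ _).const_mul _)]
        exact integral_congr_ae hpe
    _ ≤ ∫ x, c * e x ∂μ := by
        refine integral_mono_ae hpe_int (he_int.const_mul c) ?_
        filter_upwards [hp, he0] with x h₁ h₂
        exact mul_le_mul_of_nonneg_right h₁ h₂
    _ = c * (1 / 2 * ∫ x, v x ∂μ - inner ℝ (A f) f + 1 / 2 * ∫ x, A v x ∂μ) := by
        have hsub : Integrable (fun x => 1 / 2 * v x - A f x * f x) μ :=
          (hvint.const_mul _).sub (integrable_mul_Lp _ _)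
        rw [integral_const_mul, inner_eq_integral_mul, he, integral_add hsub (hAvint.const_mul _),
          integral_sub (hvint.const_mul _) (integrable_mul_Lp _ _), integral_const_mul,
          integral_const_mul]
    _ ≤ c * inner ℝ (f - A f) f := by
        refine mul_le_mul_of_nonneg_left ?_ hc
        rw [inner_sub_left]
        linarith

variable {S : Lp ℝ 2 μ →ₗ.[ℝ] Lp ℝ 2 μ} {ε : ℝ} {J : Lp ℝ 2 μ →ₗ[ℝ] Lp ℝ 2 μ}

/-- The unit contraction operates on the form `‖S f‖²`. -/
def UnitContractionOperates (S : Lp ℝ 2 μ →ₗ.[ℝ] Lp ℝ 2 μ) : Prop :=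
  ∀ f f', (f, f') ∈ S.graph → ∃ g g', (g, g') ∈ S.graph ∧
    (g =ᵐ[μ] fun x => max 0 (min (f x) 1)) ∧ ‖g'‖ ≤ ‖f'‖

/-- The unit contraction of `J h` is no farther from `h` and has no larger energy, so it is also a
minimizer of the variational problem and coincides with `J h`. -/
theorem IsResolvent.mem_unit_interval (hJ : IsResolvent S ε J) (hS : IsSelfAdjoint S)
    (hε : 0 < ε) (hc : UnitContractionOperates S) {h : Lp ℝ 2 μ}
    (h0 : ∀ᵐ x ∂μ, 0 ≤ h x) (h1 : ∀ᵐ x ∂μ, h x ≤ 1) :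
    ∀ᵐ x ∂μ, 0 ≤ J h x ∧ J h x ≤ 1 := by
  obtain ⟨u', hu, -⟩ := hJ h
  obtain ⟨w, w', hw, hwu, hle⟩ := hc _ _ hu
  have hvar := hJ.variational hS hε hu hw
  have hnorm : ‖w - h‖ ≤ ‖J h - h‖ := by
    refine Lp.norm_le_norm_of_ae_le ?_
    filter_upwards [h0, h1, hwu, Lp.coeFn_sub w h, Lp.coeFn_sub (J h) h] with x h₁ h₂ h₃ h₄ h₅
    rw [h₄, h₅, Pi.sub_apply, Pi.sub_apply, h₃, Real.norm_eq_abs, Real.norm_eq_abs]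
    rcases le_total (J h x) 1 with hx | hx
    · rw [min_eq_left hx]
      rcases le_total 0 (J h x) with hx' | hx'
      · rw [max_eq_right hx']
      · rw [max_eq_left hx', abs_of_nonpos (by linarith), abs_of_nonpos (by linarith)]
        linarith
    · rw [min_eq_right hx, max_eq_right zero_le_one, abs_of_nonneg (by linarith),
        abs_of_nonneg (by linarith)]
      linarith
  have hsq1 : ‖w - h‖ ^ 2 ≤ ‖J h - h‖ ^ 2 := by gcongr
  have hsq2 : ε * ‖w'‖ ^ 2 ≤ ε * ‖u'‖ ^ 2 := by gcongr
  have hzero : ‖w - J h‖ ^ 2 = 0 := le_antisymm (by linarith) (by positivity)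
  have hwJ : w = J h := by
    rw [pow_eq_zero_iff two_ne_zero, norm_eq_zero] at hzero
    exact sub_eq_zero.1 hzero
  rw [hwJ] at hwu
  filter_upwards [hwu] with x hx
  rw [hx]
  exact ⟨le_max_left _ _, max_le zero_le_one (min_le_right _ _)⟩

/-- By symmetry, the integral of `J h` over `s` pairs `h` with the resolvent of an indicator, which
is already known to be non-negative. Thus `h` may be unbounded. -/
theorem IsResolvent.nonneg [SigmaFinite μ] (hJ : IsResolvent S ε J) (hS : IsSelfAdjoint S)
    (hε : 0 < ε) (hc : UnitContractionOperates S) {h : Lp ℝ 2 μ}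
    (h0 : ∀ᵐ x ∂μ, 0 ≤ h x) : ∀ᵐ x ∂μ, 0 ≤ J h x := by
  refine ae_nonneg_of_forall_setIntegral_nonneg_of_sigmaFinite
    (fun s hs hμs => integrableOn_Lp_of_measure_ne_top _ (by norm_num) hμs.ne) fun s hs hμs => ?_
  rw [← L2.inner_indicatorConstLp_one hs hμs.ne, ← hJ.symm hS hε, inner_eq_integral_mul]
  have h1 := indicatorConstLp_coeFn (p := 2) (hs := hs) (hμs := hμs.ne) (c := (1 : ℝ))
  have h2 := hJ.mem_unit_interval hS hε hc (h := indicatorConstLp 2 hs hμs.ne (1 : ℝ))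
    (by
      filter_upwards [h1] with x hx
      rw [hx]
      exact Set.indicator_nonneg (by simp) x)
    (by
      filter_upwards [h1] with x hx
      rw [hx]
      exact Set.indicator_le_self' (by simp) x)
  refine integral_nonneg_of_ae ?_
  filter_upwards [h0, h2] with x h₁ h₂
  exact mul_nonneg h₂.1 h₁

theorem IsResolvent.isSubMarkov [SigmaFinite μ] (hJ : IsResolvent S ε J) (hS : IsSelfAdjoint S)
    (hε : 0 < ε) (hc : UnitContractionOperates S) : IsSubMarkov J := by
  refine ⟨hJ.symm hS hε, hJ.norm_le hS hε, fun f k hk hf => ?_⟩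
  rcases hk.eq_or_lt with rfl | hk
  · simpa using hJ.nonneg hS hε hc (by simpa using hf)
  -- With `b` the negative part of `f`, `J f = J (f + b) - J b`, where `f + b ≥ 0` and `0 ≤ b ≤ k`.
  set b : Lp ℝ 2 μ := (-f) ⊔ 0 with hb
  have hbx : ∀ᵐ x ∂μ, b x = max (-(f x)) 0 := by
    filter_upwards [Lp.coeFn_sup (-f) 0, Lp.coeFn_neg f, Lp.coeFn_zero ℝ 2 μ] with x h₁ h₂ h₃
    rw [hb, h₁, Pi.sup_apply, h₂, h₃]
    rfl
  have h1 := hJ.nonneg hS hε hc (h := f + b) (by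
    filter_upwards [hbx, Lp.coeFn_add f b] with x h₁ h₂
    rw [h₂, Pi.add_apply, h₁]
    linarith [le_max_left (-(f x)) 0])
  have h2 := hJ.mem_unit_interval hS hε hc (h := k⁻¹ • b)
    (by
      filter_upwards [hbx, Lp.coeFn_smul k⁻¹ b] with x h₁ h₂
      rw [h₂, Pi.smul_apply, h₁, smul_eq_mul]
      positivity)
    (by
      filter_upwards [hbx, hf, Lp.coeFn_smul k⁻¹ b] with x h₁ h₃ h₂
      rw [h₂, Pi.smul_apply, h₁, smul_eq_mul, inv_mul_le_one₀ hk]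
      exact max_le (by linarith) hk.le)
  rw [map_add] at h1
  rw [map_smul] at h2
  filter_upwards [h1, h2, Lp.coeFn_add (J f) (J b), Lp.coeFn_smul k⁻¹ (J b)] with x h₁ h₂ h₃ h₄
  rw [h₃, Pi.add_apply] at h₁
  rw [h₄, Pi.smul_apply, smul_eq_mul, inv_mul_le_one₀ hk] at h₂
  linarith [h₂.2]

end SubMarkov


/-! ### Total mass of the energy measure -/

section Energy

theorem form_self {X : Type*} [MeasurableSpace X] {μ : Measure X}
    {L : Lp ℝ 2 μ →ₗ.[ℝ] Lp ℝ 2 μ} (f : (sqrtOp L).domain) : form L f f = ‖sqrtOp L f‖ ^ 2 :=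
  real_inner_self_eq_norm_sq _

variable {X : Type*} [MetricSpace X] [MeasurableSpace X] {μ : Measure X}
  {L : Lp ℝ 2 μ →ₗ.[ℝ] Lp ℝ 2 μ}

theorem IsDirichlet.unitContractionOperates {X : Type*} [MeasurableSpace X] {μ : Measure X}
    {L : Lp ℝ 2 μ →ₗ.[ℝ] Lp ℝ 2 μ} (h : IsDirichlet L) :
    UnitContractionOperates (sqrtOp L) := by
  intro f f' hf
  obtain ⟨y, rfl, rfl⟩ := (LinearPMap.mem_graph_iff _).1 hf
  obtain ⟨g, hg, hle⟩ := h y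
  refine ⟨g, sqrtOp L g, LinearPMap.mem_graph _ g, hg, ?_⟩
  rw [form_self, form_self] at hle
  exact (sq_le_sq₀ (norm_nonneg _) (norm_nonneg _)).1 hle

theorem form_truncation_le [SigmaFinite μ] (hDir : IsDirichlet L) {f g : (sqrtOp L).domain}
    {k : ℝ} (hk : 0 ≤ k)
    (hg : (g : Lp ℝ 2 μ) =ᵐ[μ] fun x => max (-k) (min ((f : Lp ℝ 2 μ) x) k)) :
    form L g g ≤ form L f f := by
  have hS := isSelfAdjoint_sqrtOp L
  obtain ⟨ε, J, hε, hε0, hJ⟩ := exists_resolvent_seq hS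
  have hlim := fun f g : (sqrtOp L).domain => tendsto_resolvent_form hS hε hε0 hJ
    ((sqrtOp L).mem_graph f) ((sqrtOp L).mem_graph g)
  refine le_of_tendsto_of_tendsto' (hlim g g) (hlim f f) fun n => ?_
  have hA := (hJ n).isSubMarkov hS (hε n) hDir.unitContractionOperates
  exact mul_le_mul_of_nonneg_left (hA.inner_truncation_le hk hg) (inv_nonneg.2 (hε n).le)

theorem form_sub_half_form_sq_le [SigmaFinite μ] (hDir : IsDirichlet L)
    {f u v p : (sqrtOp L).domain} {c : ℝ} (hc : 0 ≤ c)
    (hu : (u : Lp ℝ 2 μ) =ᵐ[μ] fun x => (f : Lp ℝ 2 μ) x * (p : Lp ℝ 2 μ) x)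
    (hv : (v : Lp ℝ 2 μ) =ᵐ[μ] fun x => ((f : Lp ℝ 2 μ) x) ^ 2)
    (hp : ∀ᵐ x ∂μ, (p : Lp ℝ 2 μ) x ≤ c) :
    form L f u - 1 / 2 * form L v p ≤ c * form L f f := by
  have hS := isSelfAdjoint_sqrtOp L
  obtain ⟨ε, J, hε, hε0, hJ⟩ := exists_resolvent_seq hS
  have hlim := fun f g : (sqrtOp L).domain => tendsto_resolvent_form hS hε hε0 hJ
    ((sqrtOp L).mem_graph f) ((sqrtOp L).mem_graph g)
  refine le_of_tendsto_of_tendsto' ((hlim f u).sub ((hlim v p).const_mul (1 / 2)))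
    ((hlim f f).const_mul c) fun n => ?_
  have hA := (hJ n).isSubMarkov hS (hε n) hDir.unitContractionOperates
  have := mul_le_mul_of_nonneg_left (hA.energy_le hc hu hv hp) (inv_nonneg.2 (hε n).le)
  linarith

theorem isFiniteMeasure_energyMeasure (f : Lp ℝ 2 μ) : IsFiniteMeasure (energyMeasure L f) := by
  unfold energyMeasure
  split_ifs with h
  · exact h.choose_spec.2.1
  · infer_instance

variable [LocallyCompactSpace X] [BorelSpace X]

theorem IsBddEnergyMeasure.measureReal_le_of_isCompact [SigmaFinite μ] (hDir : IsDirichlet L)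
    (hReg : IsRegular L) {f : (sqrtOp L).domain} {m : Measure X}
    (hm : IsBddEnergyMeasure L f m) {K : Set X} (hK : IsCompact K) :
    m.real K ≤ form L f f := by
  have := hm.1
  have hE : 0 ≤ form L f f := by rw [form_self]; positivity
  obtain ⟨ψ, hψ1, -, hψc, hψ01⟩ :=
    exists_continuous_one_zero_of_isCompact hK isClosed_empty (Set.disjoint_empty K)
  -- The cut-off `ψ` need not lie in the form domain. Regularity supplies `φ` in it with `χ_K - δ ≤
  -- φ ≤ 1 + δ`, and finiteness of `m` makes the error vanish with `δ`.
  have key : ∀ δ : ℝ, 0 < δ →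
      m.real K ≤ form L f f + δ * (form L f f + m.real Set.univ) := by
    intro δ hδ
    obtain ⟨φ, p, hφ, hφc, hpφ, hclose⟩ := hReg.dense_continuous ψ ψ.continuous hψc δ hδ
    obtain ⟨u, v, hu, hv, hint⟩ := hm.2 φ p hφ hφc hpφ
    have hup : form L f u - 1 / 2 * form L v p ≤ (1 + δ) * form L f f := by
      refine form_sub_half_form_sq_le hDir (by positivity) ?_ hv ?_
      · filter_upwards [hu, hpφ] with x h₁ h₂
        rw [h₁, h₂]
      · filter_upwards [hpφ] with x hx
        rw [hx]
        have := (abs_lt.1 (hclose x)).1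
        linarith [(hψ01 x).2]
    have hlow : m.real K - δ * m.real Set.univ ≤ ∫ x, φ x ∂m := by
      have hKint : Integrable (K.indicator (1 : X → ℝ)) m :=
        (integrable_const (1 : ℝ)).indicator hK.measurableSet
      calc m.real K - δ * m.real Set.univ = ∫ x, (K.indicator (1 : X → ℝ) x - δ) ∂m := by
            rw [integral_sub hKint (integrable_const δ), integral_indicator_one hK.measurableSet,
              integral_const, smul_eq_mul, mul_comm]
        _ ≤ ∫ x, φ x ∂m := by
            refine integral_mono (hKint.sub (integrable_const δ))
              (hφ.integrable_of_hasCompactSupport hφc) fun x => ?_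
            have h2 := (abs_lt.1 (hclose x)).2
            by_cases hx : x ∈ K
            · have h1 := hψ1 hx
              simp only [Pi.one_apply] at h1
              simp only [Set.indicator_of_mem hx, Pi.one_apply]
              linarith
            · simp only [Set.indicator_of_notMem hx]
              linarith [(hψ01 x).1]
    linarith
  refine le_of_forall_pos_le_add fun η hη => ?_
  have hT : 0 < form L f f + m.real Set.univ + 1 := by positivity
  refine (key (η / (form L f f + m.real Set.univ + 1)) (by positivity)).trans ?_
  gcongr
  rw [div_mul_eq_mul_div, div_le_iff₀ hT]
  nlinarith

theorem IsBddEnergyMeasure.measure_univ_le [TopologicalSpace.SeparableSpace X] [SigmaFinite μ]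
    (hDir : IsDirichlet L) (hReg : IsRegular L) {f : (sqrtOp L).domain} {m : Measure X}
    (hm : IsBddEnergyMeasure L f m) : m Set.univ ≤ ENNReal.ofReal (form L f f) := by
  have := hm.1
  have := UniformSpace.secondCountable_of_separable X
  let K : CompactExhaustion X := default
  rw [← K.iUnion_eq, Monotone.measure_iUnion (fun _ _ h => K.subset h)]
  refine iSup_le fun n => ?_
  rw [← ofReal_measureReal]
  exact ENNReal.ofReal_le_ofReal (hm.measureReal_le_of_isCompact hDir hReg (K.isCompact n))

/-- The total energy does not exceed the value of the form. -/
theorem IsEnergyMeasure.measureReal_univ_le [TopologicalSpace.SeparableSpace X] [SigmaFinite μ]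
    (hDir : IsDirichlet L) (hReg : IsRegular L) (f : (sqrtOp L).domain) {m : Measure X}
    (hm : IsEnergyMeasure L f m) : m.real Set.univ ≤ ‖sqrtOp L f‖ ^ 2 := by
  obtain ⟨-, -, g, ν, hgν, hlim⟩ := hm
  have hle : m Set.univ ≤ ENNReal.ofReal (form L f f) := by
    refine le_of_tendsto' (hlim Set.univ MeasurableSet.univ) fun n => ?_
    refine ((hgν n).2.measure_univ_le hDir hReg).trans (ENNReal.ofReal_le_ofReal ?_)
    exact form_truncation_le hDir n.cast_nonneg (hgν n).1
  rw [← form_self]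
  exact ENNReal.toReal_le_of_le_ofReal (by rw [form_self]; positivity) hle

theorem energyMeasure_real_univ_le [TopologicalSpace.SeparableSpace X] [SigmaFinite μ]
    (hDir : IsDirichlet L) (hReg : IsRegular L) (f : (sqrtOp L).domain) :
    (energyMeasure L f).real Set.univ ≤ ‖sqrtOp L f‖ ^ 2 := by
  unfold energyMeasure
  split_ifs with h
  · exact h.choose_spec.measureReal_univ_le hDir hReg f
  · simp

end Energy

/-! ### Summation over the lattice -/

section Global

/-- Viewing `f² dμ` as a finite measure lets the same covering and multiplicity bounds serve both
the `L²` norm and the energy. -/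
theorem exists_sq_measure {X : Type*} [MeasurableSpace X] {μ : Measure X} (f : Lp ℝ 2 μ) :
    ∃ m : Measure X, IsFiniteMeasure m ∧ m.real Set.univ = ‖f‖ ^ 2 ∧
      ∀ s, MeasurableSet s → m.real s = ∫ x in s, f x ^ 2 ∂μ := by
  have hint : Integrable (fun x => f x ^ 2) μ := (Lp.memLp f).integrable_sq
  have hreal : ∀ s, MeasurableSet s →
      (μ.withDensity fun x => ENNReal.ofReal (f x ^ 2)).real s = ∫ x in s, f x ^ 2 ∂μ := by
    intro s hs
    rw [integral_eq_lintegral_of_nonneg_ae (ae_of_all _ fun x => sq_nonneg _)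
      hint.aestronglyMeasurable.restrict, measureReal_def, withDensity_apply _ hs]
  refine ⟨_, isFiniteMeasure_withDensity_ofReal hint.2, ?_, hreal⟩
  rw [hreal _ MeasurableSet.univ, setIntegral_univ, ← real_inner_self_eq_norm_sq,
    inner_eq_integral_mul]
  simp_rw [sq]

variable {X : Type*} [MetricSpace X] [MeasurableSpace X] [BorelSpace X] {μ : Measure X}

/-- The decomposition of the `L²` norm on a ball into the variance and the mean. -/
theorem setIntegral_sq_eq (f : Lp ℝ 2 μ) {p : X} {ρ : ℝ} (h0 : 0 < μ (ball p ρ))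
    (hfin : μ (ball p ρ) < ∞) :
    ∫ x in ball p ρ, f x ^ 2 ∂μ =
      ∫ y in ball p ρ, (f y - ⨍ z in ball p ρ, f z ∂μ) ^ 2 ∂μ
        + |∫ x, f x * xi μ ρ p x ∂μ| ^ 2 := by
  set B := ball p ρ with hB
  have hBm : MeasurableSet B := measurableSet_ball
  have hV : 0 < μ.real B := ENNReal.toReal_pos h0.ne' hfin.ne
  have hf1 : IntegrableOn f B μ := integrableOn_Lp_of_measure_ne_top _ (by norm_num) hfin.ne
  have hf2 : IntegrableOn (fun x => f x ^ 2) B μ := (Lp.memLp f).integrable_sq.integrableOn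
  set I := ∫ x in B, f x ∂μ with hI
  have hconst : IntegrableOn (fun _ : X => (1 : ℝ)) B μ := integrableOn_const hfin.ne
  have hxi : ∫ x, f x * xi μ ρ p x ∂μ = μ.real B ^ (-(1 / 2) : ℝ) * I := by
    have : ∀ x, f x * xi μ ρ p x = B.indicator (fun x => μ.real B ^ (-(1 / 2) : ℝ) * f x) x := by
      intro x
      by_cases hx : x ∈ B
      · simp only [xi, ← hB, Set.indicator_of_mem hx, mul_comm]
      · simp only [xi, ← hB, Set.indicator_of_notMem hx, mul_zero]
    simp_rw [this]
    rw [integral_indicator hBm, integral_const_mul]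
  have hsq : |∫ x, f x * xi μ ρ p x ∂μ| ^ 2 = I ^ 2 / μ.real B := by
    rw [hxi, sq_abs, mul_pow, ← Real.rpow_natCast, ← Real.rpow_mul hV.le]
    norm_num
    rw [Real.rpow_neg_one]
    ring
  have hvar : ∀ c : ℝ, ∫ y in B, (f y - c) ^ 2 ∂μ
      = ∫ y in B, f y ^ 2 ∂μ - 2 * c * I + c ^ 2 * μ.real B := by
    intro c
    have h1 : ∀ y, (f y - c) ^ 2 = f y ^ 2 - 2 * c * f y + c ^ 2 * 1 := fun y => by ring
    have hsub : IntegrableOn (fun y => f y ^ 2 - 2 * c * f y) B μ := hf2.sub (hf1.const_mul _)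
    simp_rw [h1]
    rw [integral_add hsub (hconst.const_mul _), integral_sub hf2 (hf1.const_mul _),
      integral_const_mul, integral_const_mul, setIntegral_const, smul_eq_mul, mul_one]
  rw [hvar, hsq, setAverage_eq, ← hI, smul_eq_mul]
  field_simp
  ring

theorem IsLattice.summable_measureReal [TopologicalSpace.SeparableSpace X] {N : ℕ} {ρ : ℝ}
    {Λ : Set X} (h : IsLattice N ρ Λ) (hρ : 0 < ρ) (m : Measure X) [IsFiniteMeasure m] :
    Summable fun p : Λ => m.real (ball (p : X) ρ) :=
  ENNReal.summable_toReal ((h.tsum_measure_le hρ m).trans_lt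
    (ENNReal.mul_lt_top (by simp) (measure_lt_top m _))).ne

theorem IsLattice.tsum_measureReal_le [TopologicalSpace.SeparableSpace X] {N : ℕ} {ρ : ℝ}
    {Λ : Set X} (h : IsLattice N ρ Λ) (hρ : 0 < ρ) (m : Measure X) [IsFiniteMeasure m] :
    ∑' p : Λ, m.real (ball (p : X) ρ) ≤ N * m.real Set.univ := by
  have h1 := ENNReal.toReal_mono (ENNReal.mul_lt_top (by simp) (measure_lt_top m _)).ne
    (h.tsum_measure_le hρ m)
  rwa [ENNReal.tsum_toReal_eq fun p => measure_ne_top m _, ENNReal.toReal_mul,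
    ENNReal.toReal_natCast] at h1

theorem IsLattice.measureReal_univ_le_tsum [TopologicalSpace.SeparableSpace X] {N : ℕ} {ρ : ℝ}
    {Λ : Set X} (h : IsLattice N ρ Λ) (hρ : 0 < ρ) (m : Measure X) [IsFiniteMeasure m] :
    m.real Set.univ ≤ ∑' p : Λ, m.real (ball (p : X) ρ) := by
  have h1 := ENNReal.toReal_mono ((h.tsum_measure_le hρ m).trans_lt
    (ENNReal.mul_lt_top (by simp) (measure_lt_top m _))).ne (h.measure_univ_le_tsum hρ m)
  rwa [ENNReal.tsum_toReal_eq fun p => measure_ne_top m _] at h1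

variable [TopologicalSpace.SeparableSpace X] [IsLocallyFiniteMeasure μ] {D : ℝ}

theorem summable_sq_coeff (hdoubling : IsDoubling μ D) (hD : 0 < D) {N : ℕ} {ρ : ℝ} {Λ : Set X}
    (hΛ : IsLattice N ρ Λ) (hρ : 0 < ρ) (f : Lp ℝ 2 μ) :
    Summable (fun p : Λ => |∫ x, f x * xi μ ρ (p : X) x ∂μ| ^ 2) ∧
      ∑' p : Λ, |∫ x, f x * xi μ ρ (p : X) x ∂μ| ^ 2 ≤ N * ‖f‖ ^ 2 := by
  obtain ⟨m, hm, huniv, hset⟩ := exists_sq_measure f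
  have hle : ∀ p : Λ, |∫ x, f x * xi μ ρ (p : X) x ∂μ| ^ 2 ≤ m.real (ball (p : X) ρ) := by
    intro p
    rw [hset _ measurableSet_ball, setIntegral_sq_eq f (hdoubling.measure_ball_pos _ hρ)
      (hdoubling.measure_ball_lt_top hD _ _)]
    have : 0 ≤ ∫ y in ball (p : X) ρ, (f y - ⨍ z in ball (p : X) ρ, f z ∂μ) ^ 2 ∂μ :=
      integral_nonneg fun _ => sq_nonneg _
    linarith
  have hsum := (hΛ.summable_measureReal hρ m).of_nonneg_of_le (fun _ => sq_nonneg _) hle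
  refine ⟨hsum, (hsum.tsum_le_tsum hle (hΛ.summable_measureReal hρ m)).trans ?_⟩
  rw [← huniv]
  exact hΛ.tsum_measureReal_le hρ m

/-- The global Poincaré inequality on the domain of `L`. -/
theorem norm_sq_le_of_mem_domain [LocallyCompactSpace X] [SigmaFinite μ]
    (hdoubling : IsDoubling μ D) (hD : 0 < D)
    {L : Lp ℝ 2 μ →ₗ.[ℝ] Lp ℝ 2 μ} (hDir : IsDirichlet L) (hReg : IsRegular L) {C r₀ : ℝ}
    (hC : 0 < C) (hP : LocalPoincare L C r₀) {N : ℕ} {ρ : ℝ} {Λ : Set X}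
    (hΛ : IsLattice N ρ Λ) (hρ : 0 < ρ) (hρr : ρ < r₀) (f : (sqrtOp L).domain)
    (hf : (f : Lp ℝ 2 μ) ∈ L.domain) :
    ‖(f : Lp ℝ 2 μ)‖ ^ 2 ≤ C * N * ρ ^ 2 * ‖sqrtOp L f‖ ^ 2 +
      ∑' p : Λ, |∫ x, (f : Lp ℝ 2 μ) x * xi μ ρ (p : X) x ∂μ| ^ 2 := by
  obtain ⟨m, hm, huniv, hset⟩ := exists_sq_measure (f : Lp ℝ 2 μ)
  have := isFiniteMeasure_energyMeasure (L := L) (f : Lp ℝ 2 μ)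
  set γ := energyMeasure L (f : Lp ℝ 2 μ) with hγ
  have hγsum := (hΛ.summable_measureReal hρ γ).mul_left (C * ρ ^ 2)
  have hcoeff := (summable_sq_coeff hdoubling hD hΛ hρ (f : Lp ℝ 2 μ)).1
  have hle : ∀ p : Λ, m.real (ball (p : X) ρ) ≤ C * ρ ^ 2 * γ.real (ball (p : X) ρ)
      + |∫ x, (f : Lp ℝ 2 μ) x * xi μ ρ (p : X) x ∂μ| ^ 2 := by
    intro p
    rw [hset _ measurableSet_ball, setIntegral_sq_eq _ (hdoubling.measure_ball_pos _ hρ)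
      (hdoubling.measure_ball_lt_top hD _ _)]
    gcongr
    exact hP f hf p ρ hρ hρr
  calc ‖(f : Lp ℝ 2 μ)‖ ^ 2 = m.real Set.univ := huniv.symm
    _ ≤ ∑' p : Λ, m.real (ball (p : X) ρ) := hΛ.measureReal_univ_le_tsum hρ m
    _ ≤ ∑' p : Λ, (C * ρ ^ 2 * γ.real (ball (p : X) ρ)
          + |∫ x, (f : Lp ℝ 2 μ) x * xi μ ρ (p : X) x ∂μ| ^ 2) :=
        (hΛ.summable_measureReal hρ m).tsum_le_tsum hle (hγsum.add hcoeff)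
    _ = C * ρ ^ 2 * ∑' p : Λ, γ.real (ball (p : X) ρ)
          + ∑' p : Λ, |∫ x, (f : Lp ℝ 2 μ) x * xi μ ρ (p : X) x ∂μ| ^ 2 := by
        rw [hγsum.tsum_add hcoeff, tsum_mul_left]
    _ ≤ C * ρ ^ 2 * (N * ‖sqrtOp L f‖ ^ 2)
          + ∑' p : Λ, |∫ x, (f : Lp ℝ 2 μ) x * xi μ ρ (p : X) x ∂μ| ^ 2 := by
        gcongr
        refine (hΛ.tsum_measureReal_le hρ γ).trans ?_
        gcongr
        exact energyMeasure_real_univ_le hDir hReg f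
    _ = _ := by ring

theorem integral_sub_mul_xi (hdoubling : IsDoubling μ D) (hD : 0 < D) (f g : Lp ℝ 2 μ) (p : X)
    (ρ : ℝ) : ∫ x, (f - g) x * xi μ ρ p x ∂μ =
      ∫ x, f x * xi μ ρ p x ∂μ - ∫ x, g x * xi μ ρ p x ∂μ := by
  have hxi : MemLp (xi μ ρ p) 2 μ :=
    memLp_indicator_const 2 measurableSet_ball _ (Or.inr (hdoubling.measure_ball_lt_top hD p ρ).ne)
  have hint : ∀ h : Lp ℝ 2 μ, Integrable (fun x => h x * xi μ ρ p x) μ :=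
    fun h => (Lp.memLp h).integrable_mul hxi
  rw [← integral_sub (hint f) (hint g)]
  refine integral_congr_ae ?_
  filter_upwards [Lp.coeFn_sub f g] with x hx
  rw [hx, Pi.sub_apply, sub_mul]

/-- Young's inequality `b² ≤ (1 + 1/α) a² + (1 + α) (b - a)²` for each coefficient; multiplicity
bounds the coefficient sum of `g - f` by `N ‖g - f‖²`. -/
theorem tsum_sq_coeff_le (hdoubling : IsDoubling μ D) (hD : 0 < D) {N : ℕ} {ρ : ℝ} {Λ : Set X}
    (hΛ : IsLattice N ρ Λ) (hρ : 0 < ρ) (f g : Lp ℝ 2 μ) {α : ℝ} (hα : 0 < α) :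
    ∑' p : Λ, |∫ x, g x * xi μ ρ (p : X) x ∂μ| ^ 2 ≤
      (1 + α) / α * ∑' p : Λ, |∫ x, f x * xi μ ρ (p : X) x ∂μ| ^ 2
        + (1 + α) * (N * ‖g - f‖ ^ 2) := by
  obtain ⟨hg, -⟩ := summable_sq_coeff hdoubling hD hΛ hρ g
  obtain ⟨hf, -⟩ := summable_sq_coeff hdoubling hD hΛ hρ f
  obtain ⟨hgf, hgfle⟩ := summable_sq_coeff hdoubling hD hΛ hρ (g - f)
  have h := hg.tsum_le_tsum (fun p => ?_)
    ((hf.mul_left ((1 + α) / α)).add (hgf.mul_left (1 + α)))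
  · rw [(hf.mul_left _).tsum_add (hgf.mul_left _), tsum_mul_left, tsum_mul_left] at h
    refine h.trans ?_
    gcongr
  · rw [integral_sub_mul_xi hdoubling hD, sq_abs, sq_abs, sq_abs]
    set a := ∫ x, f x * xi μ ρ (p : X) x ∂μ
    set b := ∫ x, g x * xi μ ρ (p : X) x ∂μ
    have : (1 + α) / α * a ^ 2 + (1 + α) * (b - a) ^ 2 - b ^ 2
        = (a - α * (b - a)) ^ 2 / α := by
      field_simp
      ring
    have h0 : 0 ≤ (a - α * (b - a)) ^ 2 / α := by positivity
    linarith

end Global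

end GlobalPoincare

theorem mainTheorem3 {X : Type*} [MetricSpace X] [LocallyCompactSpace X]
    [TopologicalSpace.SeparableSpace X] [MeasurableSpace X] [BorelSpace X]
    (μ : Measure X) [μ.Regular] (D : ℝ) (hD : 0 < D) (hdoubling : GlobalPoincare.IsDoubling μ D)
    (L : Lp ℝ 2 μ →ₗ.[ℝ] Lp ℝ 2 μ) (hL : IsSelfAdjoint L) (hL0 : GlobalPoincare.IsNonneg L)
    (hDir : GlobalPoincare.IsDirichlet L) (hReg : GlobalPoincare.IsRegular L)
    (hLoc : GlobalPoincare.IsStronglyLocal L)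
    (C r₀ : ℝ) (hC : 0 < C) (hr₀ : 0 < r₀) (hP : GlobalPoincare.LocalPoincare L C r₀) :
    (∃ N : ℕ, (N : ℝ) ≤ (80 : ℝ) ^ D ∧
      ∀ ρ : ℝ, 0 < ρ → ∃ Λ : Set X, GlobalPoincare.IsLattice N ρ Λ) ∧
    ∀ (N : ℕ) (ρ : ℝ) (Λ : Set X), 0 < ρ → ρ < r₀ → GlobalPoincare.IsLattice N ρ Λ →
      ∀ f : (GlobalPoincare.sqrtOp L).domain, ∀ α : ℝ, 0 < α →
        Summable (fun p : Λ =>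
          |∫ x, (f : Lp ℝ 2 μ) x * GlobalPoincare.xi μ ρ (p : X) x ∂μ| ^ 2) ∧
        ‖(f : Lp ℝ 2 μ)‖ ^ 2 ≤
          (1 + α) * C * N * ρ ^ 2 * ‖GlobalPoincare.sqrtOp L f‖ ^ 2 +
          (1 + α) / α *
            ∑' p : Λ, |∫ x, (f : Lp ℝ 2 μ) x * GlobalPoincare.xi μ ρ (p : X) x ∂μ| ^ 2 := by
  -- Second countability makes the locally finite measure `μ` σ-finite.
  have := UniformSpace.secondCountable_of_separable X
  refine ⟨⟨⌊(8 : ℝ) ^ D⌋₊, ?_, fun ρ hρ => GlobalPoincare.exists_isLattice hdoubling hD hρ⟩,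
    fun N ρ Λ hρ hρr hΛ f α hα =>
      ⟨(GlobalPoincare.summable_sq_coeff hdoubling hD hΛ hρ _).1, ?_⟩⟩
  · exact (Nat.floor_le (by positivity)).trans
      (Real.rpow_le_rpow (by norm_num) (by norm_num) hD.le)
  obtain ⟨g, g', hg, hlim, hlim'⟩ :=
    GlobalPoincare.exists_seq_mem_domain_tendsto hL ((GlobalPoincare.sqrtOp L).mem_graph f)
  set Q := ∑' p : Λ, |∫ x, (f : Lp ℝ 2 μ) x * GlobalPoincare.xi μ ρ (p : X) x ∂μ| ^ 2
  have hstep : ∀ n, ‖g n‖ ^ 2 ≤ C * N * ρ ^ 2 * ‖g' n‖ ^ 2 +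
      ((1 + α) / α * Q + (1 + α) * (N * ‖g n - f‖ ^ 2)) := by
    intro n
    have hdom := LinearPMap.mem_domain_of_mem_graph (hg n).2
    have h1 := GlobalPoincare.norm_sq_le_of_mem_domain hdoubling hD hDir hReg hC hP hΛ hρ hρr
      ⟨g n, hdom⟩ (hg n).1
    rw [← (LinearPMap.image_iff hdom).2 (hg n).2] at h1
    exact h1.trans (add_le_add_right
      (GlobalPoincare.tsum_sq_coeff_le hdoubling hD hΛ hρ f (g n) hα) _)
  have hzero : Tendsto (fun n => ‖g n - f‖) atTop (𝓝 0) :=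
    tendsto_iff_norm_sub_tendsto_zero.1 hlim
  have hfinal := le_of_tendsto_of_tendsto' (hlim.norm.pow 2)
    (((hlim'.norm.pow 2).const_mul (C * N * ρ ^ 2)).add
      (tendsto_const_nhds.add (((hzero.pow 2).const_mul (N : ℝ)).const_mul (1 + α)))) hstep
  refine hfinal.trans ?_
  -- The limit has coefficient `C N ρ²` in front of the energy; the stated bound adds `α` times this
  -- non-negative term.
  have : 0 ≤ α * (C * N * ρ ^ 2 * ‖GlobalPoincare.sqrtOp L f‖ ^ 2) := by positivity
  ring_nf at this ⊢
  linarith
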